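/- **Setting.** Let $n,m\in\mathbb N$, $q>0$ and $\alpha\ge 0$. A *request* is a pair $(N,r)$ of a non-empty set $N\subseteq[n]$ of compatible offline nodes and a quantity $r>0$; its set of feasible allocations is $$\Delta(N,r)=\Bigl\{x\in\mathbb R_{\ge0}^n : x(i)=0 \text{ for } i\notin N,\ \sum_{i=1}^n x(i)=r\Bigr\}.$$ Let $\mathcal E_{n,m,q}$ be the set of request sequences $E=((N_t,q_t))_{t\in[m]}$ with $\sum_{t}q_t=q$, and let $\Delta(E)=\Delta(N_1,q_1)+\dots+\Delta(N_m,q_m)$ (Minkowski sum) be the set of feasible load vectors of $E$. A *deterministic policy* $\mathcal A$ is a function that maps the history of past requests and past allocations together with the current request $(N_t,q_t)$ to an allocation $x_t\in\Delta(N_t,q_t)$; $\mathcal A(E)=\sum_{t=1}^m x_t$ is the load vector it produces on $E$. *Water-filling* $\mathrm{WF}$ is the deterministic policy that, at load vector $\ell_{t-1}=\sum_{s<t}x_s$, selects the allocation $x_t\in\Delta(N_t,q_t)$ that maximizes $\min_{i\in N_t}\{x_t(i)+\ell_{t-1}(i)\}$. For $x,y\in\mathbb R_{\ge0}^n$, $x$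 *majorizes* $y$ if $\sum_i x(i)=\sum_i y(i)$ and, for every $j\le n$, the sum of the $j$ largest entries of $x$ is at least the sum of the $j$ largest entries of $y$. A function $f:\mathbb R_{\ge0}^n\to\mathbb R_{\ge0}$ is *Schur-concave* if $f(y)\le f(x)$ whenever $y$ majorizes $x$; $g:\mathbb R_{\ge0}^n\to\mathbb R_{\ge0}$ is *Schur-convex* if $g(x)\le g(y)$ whenever $y$ majorizes $x$. The worst-case $\alpha$-regrets of a deterministic policy $\mathcal A$ are $$\mathrm{Reg}^{\max}_{(n,m,q),\alpha,f}(\mathcal A)=\sup_{E\in\mathcal E_{n,m,q}}\Bigl(\alpha\max_{\ell\in\Delta(E)}f(\ell)-f(\mathcal A(E))\Bigr),\qquad \mathrm{Reg}^{\min}_{(n,m,q),\alpha,g}(\mathcal A)=\sup_{E\in\mathcal E_{n,m,q}}\Bigl(g(\mathcal A(E))-\alpha\min_{\ell\in\Delta(E)}g(\ell)\Bigr),$$ with values in $[-\infty,\infty]$ (so $\sup\emptyset=-\infty$). **Corollary (deterministic minimax optimality of WF).** For all $n,m,q,\alpha$ as above: 1. for every Schur-concave $f:\mathbb R_{\ge0}^n\to\mathbb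 R_{\ge0}$, the maximum $\max_{\ell\in\Delta(E)}f(\ell)$ is attained for every $E\in\mathcal E_{n,m,q}$, and every deterministic policy $\mathcal A$ satisfies $\mathrm{Reg}^{\max}_{(n,m,q),\alpha,f}(\mathrm{WF})\le \mathrm{Reg}^{\max}_{(n,m,q),\alpha,f}(\mathcal A)$; 2. for every Schur-convex $g:\mathbb R_{\ge0}^n\to\mathbb R_{\ge0}$, the minimum $\min_{\ell\in\Delta(E)}g(\ell)$ is attained for every $E\in\mathcal E_{n,m,q}$, and every deterministic policy $\mathcal A$ satisfies $\mathrm{Reg}^{\min}_{(n,m,q),\alpha,g}(\mathrm{WF})\le \mathrm{Reg}^{\min}_{(n,m,q),\alpha,g}(\mathcal A)$. -/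

import Mathlib

open scoped Pointwise

/-- An online node (request): a set of compatible offline nodes among the `n` offline nodes and a
positive divisible quantity. The neighborhood is non-empty, as otherwise no feasible allocation
of the quantity exists. -/
structure Request (n : ℕ) where
  nbrs : Finset (Fin n)
  nbrs_nonempty : nbrs.Nonempty
  qty : ℝ
  qty_pos : 0 < qty

/-- The set `Δ(N, q)` of feasible allocations of a request: non-negative vectors supported on the
neighborhood (compatibility) whose entries sum to the quantity (full distribution). -/
def Request.allocations {n : ℕ} (r : Request n) : Set (Fin n → ℝ) :=
  {x | 0 ≤ x ∧ (∀ i, i ∉ r.nbrs → x i = 0) ∧ ∑ i, x i = r.qty}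

/-- The set of request sequences with `n` offline nodes, `m` online nodes (listed in order of
arrival) and total quantity `q`. -/
def requestSeqs (n m : ℕ) (q : ℝ) : Set (List (Request n)) :=
  {E | E.length = m ∧ (E.map Request.qty).sum = q}

/-- The set `Δ(E)` of feasible load vectors: the Minkowski sum of the sets of feasible allocations
of the requests in `E`. -/
def feasibleLoads {n : ℕ} (E : List (Request n)) : Set (Fin n → ℝ) :=
  (E.map Request.allocations).sum

/-- A history: the past requests, in order of arrival, with the allocations chosen for them. -/
abbrev History (n : ℕ) : Type := List (Request n × (Fin n → ℝ))

/-- The load vector after a history: the sum of all past allocations. -/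
def History.load {n : ℕ} (h : History n) : Fin n → ℝ :=
  (h.map Prod.snd).sum

/-- A deterministic online allocation policy: a function that maps the history of arrivals and
decisions together with the current request to a feasible allocation of that request. -/
structure DetPolicy (n : ℕ) where
  alloc : History n → Request n → (Fin n → ℝ)
  alloc_mem : ∀ (h : History n) (r : Request n), alloc h r ∈ r.allocations

/-- The history that results from running the policy `A` on the request sequence `E`. -/
def DetPolicy.run {n : ℕ} (A : DetPolicy n) (E : List (Request n)) : History n :=
  E.foldl (fun h r => h ++ [(r, A.alloc h r)]) []

/-- The final load vector `A(E)` of the policy `A` on the request sequence `E`. -/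
def DetPolicy.finalLoad {n : ℕ} (A : DetPolicy n) (E : List (Request n)) : Fin n → ℝ :=
  (A.run E).load

/-- The smallest load among the neighbors of the request `r` after adding the allocation `x` to the
current load vector `ℓ`. -/
def Request.minLoad {n : ℕ} (r : Request n) (ℓ x : Fin n → ℝ) : ℝ :=
  r.nbrs.inf' r.nbrs_nonempty (fun i => x i + ℓ i)

/-- `x` is a water-filling allocation of the request `r` at the load vector `ℓ`: among the feasible
allocations it maximizes the smallest resulting load of a neighbor. -/
def Request.IsWaterFilling {n : ℕ} (r : Request n) (ℓ x : Fin n → ℝ) : Prop :=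
  x ∈ r.allocations ∧ IsMaxOn (r.minLoad ℓ) r.allocations x

theorem Request.allocations_nonempty {n : ℕ} (r : Request n) : r.allocations.Nonempty := by
  obtain ⟨i, hi⟩ := r.nbrs_nonempty
  refine ⟨Pi.single i r.qty, ?_, ?_, ?_⟩
  · exact Pi.single_nonneg.2 r.qty_pos.le
  · intro j hj
    have hne : j ≠ i := fun h => hj (h ▸ hi)
    simp [hne]
  · simp

theorem Request.isCompact_allocations {n : ℕ} (r : Request n) : IsCompact r.allocations := by
  have hsub : r.allocations ⊆ Set.Icc (0 : Fin n → ℝ) (fun _ => r.qty) := by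
    rintro x ⟨h0, -, hs⟩
    refine ⟨h0, fun i => ?_⟩
    have := Finset.single_le_sum (f := x) (fun j _ => h0 j) (Finset.mem_univ i)
    simpa [hs] using this
  refine isCompact_Icc.of_isClosed_subset ?_ hsub
  have h1 : IsClosed {x : Fin n → ℝ | 0 ≤ x} := isClosed_le continuous_const continuous_id
  have h2 : IsClosed {x : Fin n → ℝ | ∀ i, i ∉ r.nbrs → x i = 0} := by
    simp only [Set.ofPred_forall]
    exact isClosed_iInter fun i => isClosed_iInter fun _ =>
      isClosed_eq (continuous_apply i) continuous_const
  have h3 : IsClosed {x : Fin n → ℝ | ∑ i, x i = r.qty} :=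
    isClosed_eq (continuous_finsetSum _ fun i _ => continuous_apply i) continuous_const
  exact h1.inter (h2.inter h3)

theorem Request.exists_isWaterFilling {n : ℕ} (r : Request n) (ℓ : Fin n → ℝ) :
    ∃ x, r.IsWaterFilling ℓ x := by
  have hc : Continuous (r.minLoad ℓ) := by
    unfold Request.minLoad
    exact Continuous.finset_inf'_apply r.nbrs_nonempty
      (fun i _ => (continuous_apply i).add continuous_const)
  exact r.isCompact_allocations.exists_isMaxOn r.allocations_nonempty hc.continuousOn

/-- The water-filling policy `WF`: at every arrival it selects the allocation that maximizes the
smallest resulting load among the neighbors of the arriving request. -/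
noncomputable def waterFilling (n : ℕ) : DetPolicy n where
  alloc h r := Classical.choose (r.exists_isWaterFilling h.load)
  alloc_mem h r := (Classical.choose_spec (r.exists_isWaterFilling h.load)).1

/-- The decreasing rearrangement of a vector. -/
noncomputable def sortDesc {n : ℕ} (x : Fin n → ℝ) : Fin n → ℝ :=
  fun i => x (Tuple.sort x i.rev)

/-- `x` majorizes `y`: the total sums agree, and for every `j` the sum of the `j` largest entries of
`x` is at least the sum of the `j` largest entries of `y`. -/
def Majorizes {n : ℕ} (x y : Fin n → ℝ) : Prop :=
  ∑ i, x i = ∑ i, y i ∧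
    ∀ j : ℕ, j ≤ n →
      ∑ i : Fin n with i.val < j, sortDesc y i ≤ ∑ i : Fin n with i.val < j, sortDesc x i

/-- Schur-concavity on the non-negative orthant. Only the values of `f` on the non-negative orthant
matter, here and below. -/
def SchurConcave {n : ℕ} (f : (Fin n → ℝ) → ℝ) : Prop :=
  ∀ x y : Fin n → ℝ, 0 ≤ x → 0 ≤ y → Majorizes y x → f y ≤ f x

/-- Schur-convexity on the non-negative orthant. -/
def SchurConvex {n : ℕ} (g : (Fin n → ℝ) → ℝ) : Prop :=
  ∀ x y : Fin n → ℝ, 0 ≤ x → 0 ≤ y → Majorizes y x → g x ≤ g y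

/-- The cost `α · max_{ℓ ∈ Δ(E)} f ℓ - f (A(E))` for a maximization objective. -/
noncomputable def costMax {n : ℕ} (α : ℝ) (f : (Fin n → ℝ) → ℝ) (A : DetPolicy n)
    (E : List (Request n)) : ℝ :=
  α * sSup (f '' feasibleLoads E) - f (A.finalLoad E)

/-- The cost `g (A(E)) - α · min_{ℓ ∈ Δ(E)} g ℓ` for a minimization objective. -/
noncomputable def costMin {n : ℕ} (α : ℝ) (g : (Fin n → ℝ) → ℝ) (A : DetPolicy n)
    (E : List (Request n)) : ℝ :=
  g (A.finalLoad E) - α * sInf (g '' feasibleLoads E)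

/-- The worst-case `α`-regret for a maximization objective, an extended real. -/
noncomputable def regMax {n : ℕ} (m : ℕ) (q α : ℝ) (f : (Fin n → ℝ) → ℝ) (A : DetPolicy n) :
    EReal :=
  ⨆ E ∈ requestSeqs n m q, (costMax α f A E : EReal)

/-- The worst-case `α`-regret for a minimization objective, an extended real. -/
noncomputable def regMin {n : ℕ} (m : ℕ) (q α : ℝ) (g : (Fin n → ℝ) → ℝ) (A : DetPolicy n) :
    EReal :=
  ⨆ E ∈ requestSeqs n m q, (costMin α g A E : EReal)

/-! For every policy `A` and sequence `E` there is a sequence `E'`, of the same length and total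
quantity, such that `A(E')` majorizes `w = WF(E)` and every feasible load of `E` is, up to
relabeling, feasible for `E'` (`exists_adversarial_seq`). On `E'` the policy thus does no better
than water-filling on `E`, while the hindsight optimum is no worse, so the regrets compare sequence
by sequence.

To build `E'`, record the level to which water-filling raises each request. Sort the requests by
level and enlarge each neighborhood to the set of all nodes whose final load under `w` is at least
that level. The neighborhoods become nested and decreasing. The adversary then chooses labels
online: whenever the neighborhood shrinks, it keeps the nodes that `A` has loaded most
(`exists_adversarial_perm`). This forces `A` to put at least as much load on each upper level set of
`w` as `w` does, and such domination implies majorization (`majorizes_of_levelSets`).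

The optimum is attained without continuity of the objective because some feasible load, the
minimizer of the sum of squares, is majorized by all others (`exists_least_majorized`). -/

/-! ### Majorization via hinge sums and level sets -/

theorem sum_sortDesc {n : ℕ} (x : Fin n → ℝ) (φ : ℝ → ℝ) :
    ∑ i, φ (sortDesc x i) = ∑ i, φ (x i) :=
  (Fin.revPerm.trans (Tuple.sort x)).sum_comp fun i => φ (x i)

theorem sortDesc_antitone {n : ℕ} (x : Fin n → ℝ) : Antitone (sortDesc x) := fun _ _ hij =>
  Tuple.monotone_sort x (Fin.rev_le_rev.2 hij)

/-- Majorization follows from domination of all hinge sums. -/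
theorem majorizes_of_sum_max_le {n : ℕ} {x y : Fin n → ℝ} (hsum : ∑ i, x i = ∑ i, y i)
    (h : ∀ c : ℝ, ∑ i, max (y i - c) 0 ≤ ∑ i, max (x i - c) 0) : Majorizes x y := by
  refine ⟨hsum, fun j hj => ?_⟩
  rcases Nat.eq_zero_or_pos j with rfl | hpos
  · simp
  set s : Finset (Fin n) := Finset.univ.filter fun i => i.val < j with hs
  -- At the `j`-th largest entry of `x` (index `j - 1` from zero) the hinge bound is tight: `j * c`
  -- plus the hinge sum of `x` equals the sum of its `j` largest entries. For `y` it is only an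
  -- upper bound.
  set c : ℝ := sortDesc x ⟨j - 1, by omega⟩ with hc
  calc ∑ i ∈ s, sortDesc y i
      ≤ ∑ i ∈ s, (c + max (sortDesc y i - c) 0) :=
        Finset.sum_le_sum fun i _ => by linarith [le_max_left (sortDesc y i - c) 0]
    _ ≤ ∑ i ∈ s, c + ∑ i, max (sortDesc y i - c) 0 := by
        rw [Finset.sum_add_distrib]
        gcongr
        exact Finset.subset_univ s
    _ ≤ ∑ i ∈ s, c + ∑ i, max (sortDesc x i - c) 0 := by
        rw [sum_sortDesc y fun v => max (v - c) 0, sum_sortDesc x fun v => max (v - c) 0]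
        linarith [h c]
    _ = ∑ i ∈ s, c + ∑ i ∈ s, max (sortDesc x i - c) 0 := by
        congr 1
        refine (Finset.sum_subset (Finset.subset_univ s) fun i _ hi => max_eq_right ?_).symm
        have : sortDesc x i ≤ c := sortDesc_antitone x (by
          simp only [hs, Finset.mem_filter, Finset.mem_univ, true_and, not_lt] at hi
          exact Fin.mk_le_of_le_val (by omega))
        linarith
    _ = ∑ i ∈ s, sortDesc x i := by
        rw [← Finset.sum_add_distrib]
        refine Finset.sum_congr rfl fun i hi => ?_
        have : c ≤ sortDesc x i := sortDesc_antitone x (by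
          simp only [hs, Finset.mem_filter, Finset.mem_univ, true_and] at hi
          exact Fin.le_def.2 (by simp; omega))
        rw [max_eq_left (by linarith)]
        ring

/-- A sum of hinges is an upper bound for every partial sum of the shifted vector. -/
theorem sum_sub_le_sum_max {ι : Type*} [Fintype ι] (x : ι → ℝ) (c : ℝ) (s : Finset ι) :
    ∑ i ∈ s, (x i - c) ≤ ∑ i, max (x i - c) 0 :=
  (Finset.sum_le_sum fun _ _ => le_max_left _ _).trans
    (Finset.sum_le_sum_of_subset_of_nonneg (Finset.subset_univ s) fun _ _ _ => le_max_right _ _)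

theorem sum_max_eq_sum_filter {ι : Type*} [Fintype ι] (x : ι → ℝ) (c : ℝ) :
    ∑ i, max (x i - c) 0 = ∑ i with c < x i, (x i - c) := by
  rw [Finset.sum_filter]
  refine Finset.sum_congr rfl fun i _ => ?_
  split_ifs with h
  · exact max_eq_left (by linarith)
  · exact max_eq_right (by linarith)

/-- Majorization follows from domination on the strict upper level sets. -/
theorem majorizes_of_levelSets {n : ℕ} {x y : Fin n → ℝ} (hsum : ∑ i, x i = ∑ i, y i)
    (h : ∀ c : ℝ, ∑ i with c < y i, y i ≤ ∑ i with c < y i, x i) : Majorizes x y := by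
  refine majorizes_of_sum_max_le hsum fun c => ?_
  rw [sum_max_eq_sum_filter y]
  refine le_trans ?_ (sum_sub_le_sum_max x c (Finset.univ.filter fun i => c < y i))
  rw [Finset.sum_sub_distrib, Finset.sum_sub_distrib]
  linarith [h c]

theorem majorizes_comp_perm {n : ℕ} {x y : Fin n → ℝ} (σ : Equiv.Perm (Fin n))
    (hxy : ∀ i, x (σ i) = y i) : Majorizes x y ∧ Majorizes y x := by
  have key (φ : ℝ → ℝ) : ∑ i, φ (x i) = ∑ i, φ (y i) := by
    rw [← Equiv.sum_comp σ]
    simp [hxy]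
  exact ⟨majorizes_of_sum_max_le (key id) fun c => (key fun v => max (v - c) 0).ge,
    majorizes_of_sum_max_le (key id).symm fun c => (key fun v => max (v - c) 0).le⟩

/-! ### Geometry of the feasible load vectors -/

theorem feasibleLoads_nil {n : ℕ} : feasibleLoads ([] : List (Request n)) = {0} := rfl

theorem feasibleLoads_cons {n : ℕ} (r : Request n) (E : List (Request n)) :
    feasibleLoads (r :: E) = r.allocations + feasibleLoads E := by
  simp [feasibleLoads]

theorem feasibleLoads_perm {n : ℕ} {E E' : List (Request n)} (h : E.Perm E') :
    feasibleLoads E = feasibleLoads E' :=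
  (h.map _).sum_eq

theorem isCompact_feasibleLoads {n : ℕ} (E : List (Request n)) : IsCompact (feasibleLoads E) := by
  induction E with
  | nil => exact isCompact_singleton
  | cons r E ih => rw [feasibleLoads_cons]; exact r.isCompact_allocations.add ih

theorem feasibleLoads_nonempty {n : ℕ} (E : List (Request n)) : (feasibleLoads E).Nonempty := by
  induction E with
  | nil => exact Set.singleton_nonempty _
  | cons r E ih => rw [feasibleLoads_cons]; exact r.allocations_nonempty.add ih

theorem Request.convex_allocations {n : ℕ} (r : Request n) : Convex ℝ r.allocations := by
  rintro x ⟨hx0, hxN, hxs⟩ y ⟨hy0, hyN, hys⟩ a b ha hb hab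
  refine ⟨add_nonneg (smul_nonneg ha hx0) (smul_nonneg hb hy0), fun i hi => ?_, ?_⟩
  · simp [hxN i hi, hyN i hi]
  · simp [Finset.sum_add_distrib, ← Finset.mul_sum, hxs, hys, ← add_mul, hab]

theorem convex_feasibleLoads {n : ℕ} (E : List (Request n)) : Convex ℝ (feasibleLoads E) := by
  induction E with
  | nil => exact convex_singleton _
  | cons r E ih => rw [feasibleLoads_cons]; exact r.convex_allocations.add ih

theorem nonneg_of_mem_feasibleLoads {n : ℕ} {E : List (Request n)} {ℓ : Fin n → ℝ}
    (h : ℓ ∈ feasibleLoads E) : 0 ≤ ℓ := by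
  induction E generalizing ℓ with
  | nil => rw [feasibleLoads_nil] at h; exact h.ge
  | cons r E ih =>
    rw [feasibleLoads_cons] at h
    obtain ⟨a, ha, b, hb, rfl⟩ := h
    exact add_nonneg ha.1 (ih hb)

theorem sum_of_mem_feasibleLoads {n : ℕ} {E : List (Request n)} {ℓ : Fin n → ℝ}
    (h : ℓ ∈ feasibleLoads E) : ∑ i, ℓ i = (E.map Request.qty).sum := by
  induction E generalizing ℓ with
  | nil => rw [feasibleLoads_nil] at h; obtain rfl := h; simp
  | cons r E ih =>
    rw [feasibleLoads_cons] at h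
    obtain ⟨a, ha, b, hb, rfl⟩ := h
    simp [Finset.sum_add_distrib, ha.2.2, ih hb]

/-! ### The least majorized feasible load -/

/-- An allocation that minimizes a linear cost also minimizes every monotone transform of it. -/
theorem Request.sum_monotone_mul_le {n : ℕ} (r : Request n) {u a : Fin n → ℝ} {φ : ℝ → ℝ}
    (hφ : Monotone φ) (ha : a ∈ r.allocations)
    (hmin : ∀ b ∈ r.allocations, ∑ i, u i * a i ≤ ∑ i, u i * b i)
    {b : Fin n → ℝ} (hb : b ∈ r.allocations) :
    ∑ i, φ (u i) * a i ≤ ∑ i, φ (u i) * b i := by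
  obtain ⟨j, hj, hju⟩ := r.nbrs.exists_min_image u r.nbrs_nonempty
  -- Comparison with the point mass on a cheapest neighbor shows that `a` charges only nodes of cost
  -- `u j`; these stay cheapest under a monotone `φ`.
  have hsingle : (Pi.single j r.qty : Fin n → ℝ) ∈ r.allocations := by
    refine ⟨Pi.single_nonneg.2 r.qty_pos.le, fun i hi => ?_, by simp⟩
    have hne : i ≠ j := fun h => hi (h ▸ hj)
    simp [hne]
  have hle : ∑ i, (u i - u j) * a i ≤ 0 := by
    have := hmin _ hsingle
    simp only [Pi.single_apply, mul_ite, mul_zero, Finset.sum_ite_eq', Finset.mem_univ, if_true]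
      at this
    simp only [sub_mul, Finset.sum_sub_distrib, ← Finset.mul_sum, ha.2.2]
    linarith
  have hnn : ∀ i ∈ Finset.univ, 0 ≤ (u i - u j) * a i := fun i _ => by
    by_cases hi : i ∈ r.nbrs
    · exact mul_nonneg (sub_nonneg.2 (hju i hi)) (ha.1 i)
    · simp [ha.2.1 i hi]
  have hzero := (Finset.sum_eq_zero_iff_of_nonneg hnn).1 (le_antisymm hle (Finset.sum_nonneg hnn))
  calc ∑ i, φ (u i) * a i = ∑ i, φ (u j) * a i := Finset.sum_congr rfl fun i _ => by
        rcases mul_eq_zero.1 (hzero i (Finset.mem_univ i)) with h | h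
        · rw [sub_eq_zero.1 h]
        · simp [h]
    _ = ∑ i, φ (u j) * b i := by rw [← Finset.mul_sum, ← Finset.mul_sum, ha.2.2, hb.2.2]
    _ ≤ ∑ i, φ (u i) * b i := Finset.sum_le_sum fun i _ => by
        by_cases hi : i ∈ r.nbrs
        · exact mul_le_mul_of_nonneg_right (hφ (hju i hi)) (hb.1 i)
        · simp [hb.2.1 i hi]

/-- A linear cost splits over a Minkowski sum, so a minimizer is a sum of minimizers for the single
requests, as seen by varying one summand with the others fixed. -/
theorem feasibleLoads_sum_monotone_mul_le {n : ℕ} {E : List (Request n)} {u x : Fin n → ℝ}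
    {φ : ℝ → ℝ} (hφ : Monotone φ) (hx : x ∈ feasibleLoads E)
    (hmin : ∀ y ∈ feasibleLoads E, ∑ i, u i * x i ≤ ∑ i, u i * y i)
    {y : Fin n → ℝ} (hy : y ∈ feasibleLoads E) :
    ∑ i, φ (u i) * x i ≤ ∑ i, φ (u i) * y i := by
  induction E generalizing x y with
  | nil => rw [feasibleLoads_nil] at hx hy; rw [hx, hy]
  | cons r E ih =>
    rw [feasibleLoads_cons] at hx hy hmin
    obtain ⟨a, ha, b, hb, rfl⟩ := hx
    obtain ⟨a', ha', b', hb', rfl⟩ := hy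
    have h1 := r.sum_monotone_mul_le hφ ha (u := u) (fun z hz => by
      have := hmin _ (Set.add_mem_add hz hb)
      simpa [mul_add, Finset.sum_add_distrib] using this) ha'
    have h2 := ih hb (fun z hz => by
      have := hmin _ (Set.add_mem_add ha hz)
      simpa [mul_add, Finset.sum_add_distrib] using this) hb'
    simp only [Pi.add_apply, mul_add, Finset.sum_add_distrib]
    linarith

/-- A minimizer of the sum of squares over a convex set minimizes the linearization there. -/
theorem sum_mul_le_of_isMinOn_sum_sq {ι : Type*} [Fintype ι] {s : Set (ι → ℝ)} (hs : Convex ℝ s)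
    {x y : ι → ℝ} (hx : x ∈ s) (hy : y ∈ s) (hmin : IsMinOn (fun z => ∑ i, z i ^ 2) s x) :
    ∑ i, x i * x i ≤ ∑ i, x i * y i := by
  by_contra! hlt
  set d := ∑ i, x i * x i - ∑ i, x i * y i with hd
  set D := ∑ i, (y i - x i) ^ 2 with hD
  have hdpos : 0 < d := by linarith
  have hDnn : 0 ≤ D := Finset.sum_nonneg fun i _ => sq_nonneg _
  -- Moving from `x` towards `y` by `ε` changes the sum of squares by `-2 * ε * d + ε ^ 2 * D`,
  -- which is negative once `ε * D ≤ d`. The `D + 1` avoids division by zero.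
  set ε := min 1 (d / (D + 1)) with hε
  have hε0 : 0 < ε := lt_min one_pos (by positivity)
  have hε1 : ε ≤ 1 := min_le_left _ _
  have hεD : ε * (D + 1) ≤ d := (le_div_iff₀ (by positivity)).1 (min_le_right _ _)
  have hz := hmin (hs hx hy (sub_nonneg.2 hε1) hε0.le (by ring))
  simp only [Set.mem_ofPred_eq] at hz
  have hexp : ∑ i, ((1 - ε) • x + ε • y) i ^ 2 = ∑ i, x i ^ 2 - 2 * ε * d + ε ^ 2 * D := by
    simp only [hd, hD, mul_sub, Finset.mul_sum, ← Finset.sum_sub_distrib, ← Finset.sum_add_distrib]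
    refine Finset.sum_congr rfl fun i _ => ?_
    simp only [Pi.add_apply, Pi.smul_apply, smul_eq_mul]
    ring
  rw [hexp] at hz
  nlinarith

/-- Every set of feasible load vectors has a least majorized element. -/
theorem exists_least_majorized {n : ℕ} (E : List (Request n)) :
    ∃ ℓ ∈ feasibleLoads E, ∀ ℓ' ∈ feasibleLoads E, Majorizes ℓ' ℓ := by
  obtain ⟨ℓ, hℓ, hmin⟩ := (isCompact_feasibleLoads E).exists_isMinOn (feasibleLoads_nonempty E)
    (f := fun z => ∑ i, z i ^ 2) (by fun_prop)
  refine ⟨ℓ, hℓ, fun ℓ' hℓ' => majorizes_of_levelSets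
    (by rw [sum_of_mem_feasibleLoads hℓ, sum_of_mem_feasibleLoads hℓ']) fun c => ?_⟩
  -- With the step function at `c`, the linear cost becomes the load on the strict upper level set
  -- of `ℓ`.
  have hφ : Monotone fun v : ℝ => if c < v then (1 : ℝ) else 0 := by
    intro a b hab
    dsimp only
    split_ifs <;> linarith
  have := feasibleLoads_sum_monotone_mul_le hφ hℓ (fun y hy =>
    sum_mul_le_of_isMinOn_sum_sq (convex_feasibleLoads E) hℓ hy hmin) hℓ'
  simpa [Finset.sum_filter, ite_mul] using this

/-! ### Runs of a policy -/

/-- The history that results from running the policy `A` on `E` after the history `h`. -/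
def DetPolicy.runFrom {n : ℕ} (A : DetPolicy n) (h : History n) (E : List (Request n)) :
    History n :=
  E.foldl (fun h r => h ++ [(r, A.alloc h r)]) h

theorem History.load_append_singleton {n : ℕ} (h : History n) (r : Request n) (x : Fin n → ℝ) :
    History.load (h ++ [(r, x)]) = h.load + x := by
  simp [History.load]

theorem DetPolicy.exists_load_runFrom {n : ℕ} (A : DetPolicy n) (h : History n)
    (E : List (Request n)) : ∃ x ∈ feasibleLoads E, (A.runFrom h E).load = h.load + x := by
  induction E generalizing h with
  | nil => exact ⟨0, rfl, (add_zero _).symm⟩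
  | cons r E ih =>
    obtain ⟨x, hx, hload⟩ := ih (h ++ [(r, A.alloc h r)])
    refine ⟨A.alloc h r + x, ?_, ?_⟩
    · rw [feasibleLoads_cons]
      exact Set.add_mem_add (A.alloc_mem h r) hx
    · rw [← add_assoc, ← h.load_append_singleton r, ← hload]
      rfl

theorem DetPolicy.finalLoad_mem {n : ℕ} (A : DetPolicy n) (E : List (Request n)) :
    A.finalLoad E ∈ feasibleLoads E := by
  obtain ⟨x, hx, hload⟩ := A.exists_load_runFrom [] E
  have h0 : History.load ([] : History n) = 0 := rfl
  rw [h0, zero_add] at hload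
  change (A.runFrom [] E).load ∈ _
  rwa [hload]

theorem DetPolicy.finalLoad_append_singleton {n : ℕ} (A : DetPolicy n) (E : List (Request n))
    (r : Request n) : A.finalLoad (E ++ [r]) = A.finalLoad E + A.alloc (A.run E) r := by
  rw [DetPolicy.finalLoad, DetPolicy.run, List.foldl_append]
  exact History.load_append_singleton _ _ _

theorem sum_subset_of_mem_feasibleLoads {n : ℕ} {E : List (Request n)} {x : Fin n → ℝ}
    (hx : x ∈ feasibleLoads E) {M : Finset (Fin n)} (hM : ∀ r ∈ E, r.nbrs ⊆ M) :
    ∑ i ∈ M, x i = (E.map Request.qty).sum := by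
  rw [← sum_of_mem_feasibleLoads hx]
  refine Finset.sum_subset (Finset.subset_univ M) fun i _ hi => ?_
  induction E generalizing x with
  | nil => rw [feasibleLoads_nil] at hx; rw [hx]; rfl
  | cons r E ih =>
    rw [feasibleLoads_cons] at hx
    obtain ⟨a, ha, b, hb, rfl⟩ := hx
    have h1 := ha.2.1 i fun h => hi (hM r (by simp) h)
    have h2 := ih hb fun r hr => hM r (by simp [hr])
    simp [h1, h2]

/-! ### Water levels -/

/-- In a water-filling allocation, every node that receives water ends at the smallest level. -/
theorem Request.IsWaterFilling.add_le_minLoad {n : ℕ} {r : Request n} {ℓ x : Fin n → ℝ}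
    (h : r.IsWaterFilling ℓ x) {i : Fin n} (hi : 0 < x i) : x i + ℓ i ≤ r.minLoad ℓ x := by
  obtain ⟨⟨h0, hN, hs⟩, hmax⟩ := h
  by_contra! hlt
  have hiN : i ∈ r.nbrs := by
    by_contra hiN
    exact hi.ne' (hN i hiN)
  set k : ℝ := (r.nbrs.card : ℝ) with hk
  have hkpos : 0 < k := by
    rw [hk]
    exact_mod_cast r.nbrs_nonempty.card_pos
  -- Take `ε` from node `i` and spread it evenly over all neighbors. The first bound keeps the
  -- allocation non-negative; half the gap keeps `i` above the old minimum, so the minimum strictly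
  -- increases.
  set ε := min (x i) ((x i + ℓ i - r.minLoad ℓ x) / 2) with hε
  have hε0 : 0 < ε := lt_min hi (by linarith)
  have hεx : ε ≤ x i := min_le_left _ _
  have hεm : ε ≤ (x i + ℓ i - r.minLoad ℓ x) / 2 := min_le_right _ _
  have hδ : 0 < ε / k := by positivity
  set y : Fin n → ℝ := fun j =>
    x j + ((if j ∈ r.nbrs then ε / k else 0) - if j = i then ε else 0) with hy
  have hyi (j : Fin n) (hj : j ∈ r.nbrs) (hji : j ≠ i) : y j = x j + ε / k := by
    simp [hy, hj, hji]
  have hyi' : y i = x i + ε / k - ε := by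
    simp [hy, hiN]
    ring
  have hymem : y ∈ r.allocations := by
    refine ⟨fun j => ?_, fun j hj => ?_, ?_⟩
    · by_cases hji : j = i
      · rw [hji, hyi']
        simp only [Pi.zero_apply]
        linarith
      · by_cases hj : j ∈ r.nbrs
        · rw [hyi j hj hji]
          exact add_nonneg (h0 j) hδ.le
        · simpa [hy, hj, hji] using h0 j
    · have hji : j ≠ i := fun h => hj (h ▸ hiN)
      simp [hy, hj, hji, hN j hj]
    · simp only [hy, Finset.sum_add_distrib, Finset.sum_sub_distrib, hs]
      rw [Finset.sum_ite_mem, Finset.univ_inter, Finset.sum_const, nsmul_eq_mul, ← hk]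
      simp [mul_div_cancel₀ ε hkpos.ne']
  have hle : r.minLoad ℓ y ≤ r.minLoad ℓ x := hmax hymem
  refine hle.not_gt ((Finset.lt_inf'_iff r.nbrs_nonempty).2 fun j hj => ?_)
  by_cases hji : j = i
  · rw [hji, hyi']
    linarith
  · rw [hyi j hj hji]
    have : r.minLoad ℓ x ≤ x j + ℓ j := Finset.inf'_le (fun i => x i + ℓ i) hj
    linarith

/-- The water levels of a run of water-filling: `L` pairs every request with the level to which
its neighbors were filled, and `w` is the final load vector. -/
structure IsLevelList {n : ℕ} (w : Fin n → ℝ) (L : List (ℝ × Request n)) : Prop where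
  level_nonneg : ∀ p ∈ L, 0 ≤ p.1
  level_le : ∀ p ∈ L, ∀ i ∈ p.2.nbrs, p.1 ≤ w i
  eq_level : ∀ i, w i = 0 ∨ ∃ p ∈ L, w i = p.1
  sum_max_le : ∀ c, 0 ≤ c →
    ∑ i, max (w i - c) 0 ≤ (L.map fun p => if c < p.1 then p.2.qty else 0).sum

theorem IsLevelList.perm {n : ℕ} {w : Fin n → ℝ} {L L' : List (ℝ × Request n)}
    (h : IsLevelList w L) (hp : L.Perm L') : IsLevelList w L' where
  level_nonneg p hpL := h.level_nonneg p (hp.mem_iff.2 hpL)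
  level_le p hpL := h.level_le p (hp.mem_iff.2 hpL)
  eq_level i := (h.eq_level i).imp_right fun ⟨p, hpL, hi⟩ => ⟨p, hp.mem_iff.1 hpL, hi⟩
  sum_max_le c hc := (h.sum_max_le c hc).trans_eq (hp.map _).sum_eq

/-- Every node that receives water ends exactly at the level of the request. Hence a request of
level at most `c` leaves the hinge sum at `c` unchanged, and any other raises it by at most its
quantity. -/
theorem waterFilling_exists_isLevelList {n : ℕ} (E : List (Request n)) :
    ∃ L : List (ℝ × Request n), L.map Prod.snd = E ∧
      IsLevelList ((waterFilling n).finalLoad E) L := by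
  induction E using List.reverseRecOn with
  | nil =>
    refine ⟨[], rfl, by simp, by simp, fun i => Or.inl rfl, fun c hc => ?_⟩
    refine Finset.sum_nonpos fun i _ => max_le ?_ le_rfl
    exact sub_nonpos.2 hc
  | append_singleton E r ih =>
    obtain ⟨L, hLE, hL⟩ := ih
    set ℓ := (waterFilling n).finalLoad E with hℓ
    set x := (waterFilling n).alloc ((waterFilling n).run E) r with hx
    have hwf : r.IsWaterFilling ℓ x := Classical.choose_spec (r.exists_isWaterFilling _)
    have hx0 : 0 ≤ x := hwf.1.1
    have hℓ0 : 0 ≤ ℓ := nonneg_of_mem_feasibleLoads ((waterFilling n).finalLoad_mem E)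
    have hge (i : Fin n) (hi : i ∈ r.nbrs) : r.minLoad ℓ x ≤ x i + ℓ i :=
      Finset.inf'_le (fun i => x i + ℓ i) hi
    have heq (i : Fin n) (hi : 0 < x i) : x i + ℓ i = r.minLoad ℓ x := by
      refine le_antisymm (hwf.add_le_minLoad hi) (hge i ?_)
      by_contra hiN
      exact hi.ne' (hwf.1.2.1 i hiN)
    rw [DetPolicy.finalLoad_append_singleton, ← hℓ, ← hx]
    refine ⟨L ++ [(r.minLoad ℓ x, r)], by simp [hLE], ?_, ?_, ?_, ?_⟩
    · intro p hp
      rcases List.mem_append.1 hp with hp | hp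
      · exact hL.level_nonneg p hp
      · obtain rfl := List.mem_singleton.1 hp
        exact Finset.le_inf' r.nbrs_nonempty _ fun i _ => add_nonneg (hx0 i) (hℓ0 i)
    · intro p hp i hi
      rcases List.mem_append.1 hp with hp | hp
      · exact (hL.level_le p hp i hi).trans (le_add_of_nonneg_right (hx0 i))
      · obtain rfl := List.mem_singleton.1 hp
        exact (hge i hi).trans_eq (add_comm _ _)
    · intro i
      rcases (hx0 i).eq_or_lt with hi | hi
      · have : (ℓ + x) i = ℓ i := by simp [← hi]
        rw [this]
        exact (hL.eq_level i).imp_right fun ⟨p, hp, h⟩ => ⟨p, List.mem_append_left _ hp, h⟩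
      · exact Or.inr ⟨(r.minLoad ℓ x, r), by simp, by rw [← heq i hi, Pi.add_apply, add_comm]⟩
    · intro c hc
      have ih := hL.sum_max_le c hc
      simp only [List.map_append, List.sum_append, List.map_cons, List.map_nil, List.sum_cons,
        List.sum_nil, add_zero]
      split_ifs with hcm
      · have : ∑ i, max ((ℓ + x) i - c) 0 ≤ ∑ i, (max (ℓ i - c) 0 + x i) :=
          Finset.sum_le_sum fun i _ => by
            have := hx0 i
            simp only [Pi.zero_apply] at this
            rw [Pi.add_apply]
            exact max_le (by linarith [le_max_left (ℓ i - c) 0])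
              (by linarith [le_max_right (ℓ i - c) 0])
        rw [Finset.sum_add_distrib, hwf.1.2.2] at this
        linarith
      · have : ∑ i, max ((ℓ + x) i - c) 0 = ∑ i, max (ℓ i - c) 0 :=
          Finset.sum_congr rfl fun i _ => by
            rcases (hx0 i).eq_or_lt with hi | hi
            · simp [← hi]
            · have h1 := heq i hi
              simp only [Pi.zero_apply] at hi
              rw [Pi.add_apply, max_eq_right (by linarith), max_eq_right (by linarith)]
        linarith

/-! ### The adaptive adversary -/

/-- The upper level set of `w` at `θ`. -/
noncomputable def upperSet {n : ℕ} (w : Fin n → ℝ) (θ : ℝ) : Finset (Fin n) :=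
  Finset.univ.filter fun i => θ ≤ w i

theorem mem_upperSet {n : ℕ} {w : Fin n → ℝ} {θ : ℝ} {i : Fin n} :
    i ∈ upperSet w θ ↔ θ ≤ w i := by
  simp [upperSet]

theorem upperSet_subset {n : ℕ} {w : Fin n → ℝ} {θ θ' : ℝ} (h : θ ≤ θ') :
    upperSet w θ' ⊆ upperSet w θ := fun _ hi =>
  mem_upperSet.2 (h.trans (mem_upperSet.1 hi))

/-- The request with level `p.1` enlarged by all nodes of final load at least `p.1` and then
relabeled by `σ`. -/
noncomputable def relabel {n : ℕ} (w : Fin n → ℝ) (σ : Equiv.Perm (Fin n)) (p : ℝ × Request n) :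
    Request n where
  nbrs := (p.2.nbrs ∪ upperSet w p.1).map σ.toEmbedding
  nbrs_nonempty := (p.2.nbrs_nonempty.mono Finset.subset_union_left).map
  qty := p.2.qty
  qty_pos := p.2.qty_pos

/-- This makes the online relabeling consistent: permuting labels later, inside a smaller set, does
not alter the requests already issued. -/
theorem map_perm_eq_of_eq_off {α : Type*} {σ τ : Equiv.Perm α} {s : Finset α}
    (h : ∀ i, i ∉ s → τ i = σ i) : s.map τ.toEmbedding = s.map σ.toEmbedding := by
  refine Finset.eq_of_subset_of_card_le (fun j hj => ?_) (by simp)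
  obtain ⟨i, hi, rfl⟩ := Finset.mem_map.1 hj
  refine Finset.mem_map.2 ⟨σ.symm (τ i), ?_, by simp⟩
  by_contra hni
  have h1 := h _ hni
  rw [Equiv.apply_symm_apply] at h1
  rw [τ.injective h1] at hni
  exact hni hi

/-- A permutation can be modified inside `s` so that a subset `t` of `s` receives the largest
values of `ℓ`. -/
theorem exists_perm_top {n : ℕ} (ℓ : Fin n → ℝ) (σ : Equiv.Perm (Fin n)) {s t : Finset (Fin n)}
    (hts : t ⊆ s) : ∃ τ : Equiv.Perm (Fin n), (∀ i, i ∉ s → τ i = σ i) ∧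
      ∀ i ∈ t, ∀ j ∈ s \ t, ℓ (τ j) ≤ ℓ (τ i) := by
  classical
  -- Among the finitely many admissible permutations take one maximizing the load on `t`; a
  -- violating pair could be swapped to increase it.
  obtain ⟨τ, hτ, hmax⟩ := (Finset.univ.filter fun τ : Equiv.Perm (Fin n) =>
    ∀ i, i ∉ s → τ i = σ i).exists_max_image (fun τ => ∑ i ∈ t, ℓ (τ i)) ⟨σ, by simp⟩
  simp only [Finset.mem_filter, Finset.mem_univ, true_and] at hτ hmax
  refine ⟨τ, hτ, fun i hi j hj => ?_⟩
  obtain ⟨hjs, hjt⟩ := Finset.mem_sdiff.1 hj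
  have hswap := hmax ((Equiv.swap i j).trans τ) fun k hk => by
    have hki : k ≠ i := fun h => hk (h ▸ hts hi)
    have hkj : k ≠ j := fun h => hk (h ▸ hjs)
    rw [Equiv.trans_apply, Equiv.swap_apply_of_ne_of_ne hki hkj, hτ k hk]
  rw [← Finset.add_sum_erase t _ hi, ← Finset.add_sum_erase t _ hi] at hswap
  have hrest : ∑ k ∈ t.erase i, ℓ (((Equiv.swap i j).trans τ) k) = ∑ k ∈ t.erase i, ℓ (τ k) :=
    Finset.sum_congr rfl fun k hk => by
      obtain ⟨hki, hkt⟩ := Finset.mem_erase.1 hk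
      have hkj : k ≠ j := fun h => hjt (h ▸ hkt)
      rw [Equiv.trans_apply, Equiv.swap_apply_of_ne_of_ne hki hkj]
  rw [hrest, Equiv.trans_apply, Equiv.swap_apply_left] at hswap
  linarith

/-- If the entries on `t` dominate those on `s \ t`, then either all entries on `t` are at least
`θ`, or all entries on `s \ t` are at most `θ`. -/
theorem forall_ge_or_forall_le {α : Type*} [DecidableEq α] {b : α → ℝ} {s t : Finset α} (θ : ℝ)
    (h : ∀ i ∈ t, ∀ j ∈ s \ t, b j ≤ b i) :
    (∀ i ∈ t, θ ≤ b i) ∨ ∀ j ∈ s \ t, b j ≤ θ := by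
  by_contra! hcon
  obtain ⟨⟨i, hi, hib⟩, j, hj, hjb⟩ := hcon
  linarith [h i hi j hj]

/-- The adaptive adversary: against every policy, the nested requests can be relabeled online so
that on each upper level set of `w` the policy places at least as much load as `w` does. -/
theorem exists_adversarial_perm {n : ℕ} (A : DetPolicy n) (w : Fin n → ℝ)
    (L : List (ℝ × Request n)) (θ₀ : ℝ) (h : History n) (σ : Equiv.Perm (Fin n))
    (hsorted : L.Pairwise fun p p' => p.1 ≤ p'.1) (hθ₀ : ∀ p ∈ L, θ₀ ≤ p.1)
    (hlevel : ∀ p ∈ L, ∀ i ∈ p.2.nbrs, p.1 ≤ w i)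
    (hmass : ∀ c, θ₀ ≤ c →
      ∑ i, max (w i - c) 0 ≤ (L.map fun p => if c < p.1 then p.2.qty else 0).sum)
    (hload : ∑ i ∈ upperSet w θ₀, w i ≤
      ∑ i ∈ upperSet w θ₀, h.load (σ i) + (L.map fun p => p.2.qty).sum) :
    ∃ τ : Equiv.Perm (Fin n), (∀ i, i ∉ upperSet w θ₀ → τ i = σ i) ∧
      ∀ θ, (θ = θ₀ ∨ ∃ p ∈ L, θ = p.1) → ∑ i ∈ upperSet w θ, w i ≤
        ∑ i ∈ upperSet w θ, (A.runFrom h (L.map (relabel w τ))).load (τ i) := by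
  classical
  -- The invariant is `hload`: on the current level set, the load so far plus all remaining quantity
  -- covers `w`. All remaining requests stay inside this set.
  induction L generalizing θ₀ h σ with
  | nil =>
    refine ⟨σ, fun _ _ => rfl, fun θ hθ => ?_⟩
    obtain rfl : θ = θ₀ := by simpa using hθ
    simpa [DetPolicy.runFrom] using hload
  | cons p L ih =>
    obtain ⟨hpL, hsorted'⟩ := List.pairwise_cons.1 hsorted
    have hp₀ : θ₀ ≤ p.1 := hθ₀ p (by simp)
    have hsub : upperSet w p.1 ⊆ upperSet w θ₀ := upperSet_subset hp₀
    have hunion (p' : ℝ × Request n) (hp' : p' ∈ p :: L) :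
        p'.2.nbrs ∪ upperSet w p'.1 = upperSet w p'.1 :=
      Finset.union_eq_right.2 fun i hi => mem_upperSet.2 (hlevel p' hp' i hi)
    obtain ⟨σ₁, hσ₁, htop⟩ := exists_perm_top h.load σ hsub
    set r := relabel w σ₁ p with hr
    set h₁ : History n := h ++ [(r, A.alloc h r)] with hh₁
    have hload₁ : h₁.load = h.load + A.alloc h r := h.load_append_singleton r _
    have hmem := A.alloc_mem h r
    have hrN : r.nbrs = (upperSet w p.1).map σ₁.toEmbedding := by
      exact congrArg (Finset.map σ₁.toEmbedding) (hunion p (by simp))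
    have halloc : ∑ i ∈ upperSet w p.1, A.alloc h r (σ₁ i) = p.2.qty := by
      have h1 : ∑ i ∈ r.nbrs, A.alloc h r i = p.2.qty :=
        (Finset.sum_subset (Finset.subset_univ _) fun i _ hi => hmem.2.1 i hi).trans hmem.2.2
      rw [hrN, Finset.sum_map] at h1
      exact h1
    have hσsum (u : Fin n → ℝ) {τ : Equiv.Perm (Fin n)} (hτ : ∀ i, i ∉ upperSet w θ₀ → τ i = σ i) :
        ∑ i ∈ upperSet w θ₀, u (τ i) = ∑ i ∈ upperSet w θ₀, u (σ i) := by
      have := congrArg (fun s => ∑ i ∈ s, u i) (map_perm_eq_of_eq_off hτ)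
      simpa using this
    have hqty : ((p :: L).map fun p => p.2.qty).sum = p.2.qty + (L.map fun p => p.2.qty).sum := by
      simp
    rw [hqty] at hload
    have hkey : ∑ i ∈ upperSet w p.1, w i ≤
        ∑ i ∈ upperSet w p.1, h.load (σ₁ i) + (p.2.qty + (L.map fun p => p.2.qty).sum) := by
      -- The invariant survives shrinking. If all kept nodes have load at least `θ₀`, the excess of
      -- `w` over `θ₀` is covered by the remaining quantity, by `hmass`. Otherwise every dropped
      -- node has load at most `θ₀`, hence at most its `w`-value, and dropping it loses nothing.
      rcases forall_ge_or_forall_le (b := fun i => h.load (σ₁ i)) θ₀ htop with hge | hle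
      · have h1 : ∑ i, max (w i - θ₀) 0 ≤ p.2.qty + (L.map fun p => p.2.qty).sum := by
          refine (hmass θ₀ le_rfl).trans (le_of_le_of_eq (List.sum_le_sum fun p' _ => ?_) hqty)
          split_ifs
          · exact le_rfl
          · exact p'.2.qty_pos.le
        have h2 := sum_sub_le_sum_max w θ₀ (upperSet w p.1)
        have h3 := Finset.sum_le_sum hge
        rw [Finset.sum_sub_distrib] at h2
        linarith
      · have h1 := Finset.sum_sdiff hsub (f := fun i => h.load (σ₁ i))
        have h2 := Finset.sum_sdiff hsub (f := w)
        have h3 : ∑ i ∈ upperSet w θ₀ \ upperSet w p.1, h.load (σ₁ i) ≤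
            ∑ i ∈ upperSet w θ₀ \ upperSet w p.1, w i := Finset.sum_le_sum fun i hi =>
          (hle i hi).trans (mem_upperSet.1 (Finset.mem_sdiff.1 hi).1)
        have h4 := hσsum h.load hσ₁
        linarith
    obtain ⟨τ, hτ, hfin⟩ := ih p.1 h₁ σ₁ hsorted' hpL
      (fun p' hp' => hlevel p' (by simp [hp']))
      -- The head request does not count towards `hmass` at `c ≥ p.1`, so the bound passes to the
      -- tail.
      (fun c hc => by
        have := hmass c (hp₀.trans hc)
        simpa [not_lt.2 hc] using this)
      (by
        simp only [hload₁, Pi.add_apply, Finset.sum_add_distrib, halloc]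
        linarith)
    have hτσ (i : Fin n) (hi : i ∉ upperSet w θ₀) : τ i = σ i :=
      (hτ i fun h => hi (hsub h)).trans (hσ₁ i hi)
    have hrτ : relabel w τ p = r := by
      rw [hr, relabel, relabel, Request.mk.injEq]
      rw [hunion p (by simp)]
      exact ⟨map_perm_eq_of_eq_off hτ, rfl⟩
    refine ⟨τ, hτσ, fun θ hθ => ?_⟩
    by_cases hθθ₀ : θ = θ₀
    -- All of the remaining quantity lands in this level set, so its final load is the right-hand
    -- side of `hload`.
    · obtain ⟨x, hx, hrun⟩ := A.exists_load_runFrom h ((p :: L).map (relabel w τ))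
      have hxsum := sum_subset_of_mem_feasibleLoads hx
        (M := (upperSet w θ₀).map τ.toEmbedding) (by
          intro r' hr'
          obtain ⟨p', hp', rfl⟩ := List.mem_map.1 hr'
          change (p'.2.nbrs ∪ upperSet w p'.1).map τ.toEmbedding ⊆ _
          rw [hunion p' hp']
          exact Finset.map_subset_map.2 (upperSet_subset (hθ₀ p' hp')))
      rw [List.map_map, Finset.sum_map] at hxsum
      have hq' : ((p :: L).map (Request.qty ∘ relabel w τ)).sum =
        p.2.qty + (L.map fun p => p.2.qty).sum := hqty
      rw [hq'] at hxsum
      simp only [Equiv.coe_toEmbedding] at hxsum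
      rw [hθθ₀, hrun]
      simp only [Pi.add_apply, Finset.sum_add_distrib]
      rw [hxsum, hσsum h.load hτσ]
      exact hload
    · have hθ' : θ = p.1 ∨ ∃ p' ∈ L, θ = p'.1 := by simpa [hθθ₀] using hθ
      have := hfin θ hθ'
      rw [List.map_cons, hrτ]
      exact this

/-- Enlarging neighborhoods only adds allocations, so the hindsight optimizer loses nothing. -/
theorem comp_symm_mem_feasibleLoads {n : ℕ} (w : Fin n → ℝ) (τ : Equiv.Perm (Fin n))
    {L : List (ℝ × Request n)} {x : Fin n → ℝ} (hx : x ∈ feasibleLoads (L.map Prod.snd)) :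
    x ∘ τ.symm ∈ feasibleLoads (L.map (relabel w τ)) := by
  induction L generalizing x with
  | nil =>
    rw [List.map_nil, feasibleLoads_nil] at hx ⊢
    rw [hx]
    rfl
  | cons p L ih =>
    rw [List.map_cons, feasibleLoads_cons] at hx ⊢
    obtain ⟨a, ha, b, hb, rfl⟩ := hx
    refine Set.mem_add.2 ⟨a ∘ τ.symm, ⟨fun i => ha.1 (τ.symm i), fun i hi => ha.2.1 _ fun hi' => hi ?_, ?_⟩,
      b ∘ τ.symm, ih hb, rfl⟩
    · exact Finset.mem_map.2 ⟨τ.symm i, Finset.mem_union_left _ hi', by simp⟩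
    · exact (Equiv.sum_comp τ.symm a).trans ha.2.2

/-- Every policy has, for every request sequence `E`, a request sequence `E'` on which it ends at a
load vector majorizing that of water-filling on `E`, while every feasible load vector of `E` is, up
to relabeling, feasible for `E'`. -/
theorem exists_adversarial_seq {n m : ℕ} {q : ℝ} (A : DetPolicy n) {E : List (Request n)}
    (hE : E ∈ requestSeqs n m q) : ∃ E' ∈ requestSeqs n m q,
      Majorizes (A.finalLoad E') ((waterFilling n).finalLoad E) ∧
      ∀ ℓ ∈ feasibleLoads E, ∃ ℓ' ∈ feasibleLoads E', Majorizes ℓ ℓ' ∧ Majorizes ℓ' ℓ := by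
  classical
  obtain ⟨L₀, hL₀E, hL₀⟩ := waterFilling_exists_isLevelList E
  set w := (waterFilling n).finalLoad E with hw
  have hwmem : w ∈ feasibleLoads E := (waterFilling n).finalLoad_mem E
  have hw0 : 0 ≤ w := nonneg_of_mem_feasibleLoads hwmem
  set L := L₀.insertionSort fun p p' => p.1 ≤ p'.1 with hLdef
  have : Std.Total fun p p' : ℝ × Request n => p.1 ≤ p'.1 := ⟨fun p p' => le_total p.1 p'.1⟩
  have : IsTrans (ℝ × Request n) fun p p' => p.1 ≤ p'.1 := ⟨fun _ _ _ => le_trans⟩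
  have hsorted : L.Pairwise fun p p' => p.1 ≤ p'.1 := List.pairwise_insertionSort _ L₀
  have hperm : L₀.Perm L := (List.perm_insertionSort _ L₀).symm
  have hL : IsLevelList w L := hL₀.perm hperm
  have hLE : E.Perm (L.map Prod.snd) := hL₀E ▸ hperm.map _
  have hqty : (L.map fun p => p.2.qty).sum = (E.map Request.qty).sum := by
    rw [(hLE.map Request.qty).sum_eq, List.map_map]
    rfl
  -- Starting at `θ₀ = 0` makes the first level set all of `Fin n`, since `w` is non-negative, and
  -- also covers the value `0` in `eq_level`.
  obtain ⟨τ, -, hτ⟩ := exists_adversarial_perm A w L 0 [] 1 hsorted hL.level_nonneg hL.level_le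
    hL.sum_max_le (by
      rw [hqty, ← sum_of_mem_feasibleLoads hwmem]
      simpa [History.load] using Finset.sum_le_sum_of_subset_of_nonneg
        (Finset.subset_univ (upperSet w 0)) fun i _ _ => hw0 i)
  have hqty' : ((L.map (relabel w τ)).map Request.qty).sum = (E.map Request.qty).sum := by
    rw [← hqty, List.map_map]
    rfl
  refine ⟨L.map (relabel w τ), ⟨?_, hqty'.trans hE.2⟩, ?_, fun ℓ hℓ => ?_⟩
  · rw [List.length_map, ← List.length_map (f := Prod.snd), ← hLE.length_eq, hE.1]
  · set a := A.finalLoad (L.map (relabel w τ)) with ha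
    have hamem : a ∈ feasibleLoads (L.map (relabel w τ)) := A.finalLoad_mem _
    have hsum (φ : ℝ → ℝ) : ∑ i, φ (a (τ i)) = ∑ i, φ (a i) := Equiv.sum_comp τ fun i => φ (a i)
    refine majorizes_of_sum_max_le ?_ fun c => ?_
    · rw [sum_of_mem_feasibleLoads hamem, sum_of_mem_feasibleLoads hwmem, hqty']
    · rw [← hsum fun v => max (v - c) 0, sum_max_eq_sum_filter w]
      set s : Finset (Fin n) := Finset.univ.filter fun i => c < w i with hs
      refine le_trans ?_ (sum_sub_le_sum_max (fun i => a (τ i)) c s)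
      rw [Finset.sum_sub_distrib, Finset.sum_sub_distrib]
      refine sub_le_sub_right ?_ _
      rcases s.eq_empty_or_nonempty with hempty | hne
      · simp [hempty]
      · obtain ⟨i, hi, hmin⟩ := s.exists_min_image w hne
        -- A non-empty strict upper level set is the closed one at its smallest value of `w`, which
        -- is `0` or a water level, where `hτ` applies.
        have hsw : s = upperSet w (w i) := by
          ext j
          refine ⟨fun hj => mem_upperSet.2 (hmin j hj), fun hj => ?_⟩
          exact Finset.mem_filter.2 ⟨Finset.mem_univ j,
            (Finset.mem_filter.1 hi).2.trans_le (mem_upperSet.1 hj)⟩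
        rw [hsw]
        exact hτ (w i) (hL.eq_level i)
  · rw [feasibleLoads_perm hLE] at hℓ
    refine ⟨_, comp_symm_mem_feasibleLoads w τ hℓ, ?_⟩
    exact (majorizes_comp_perm τ fun i => by simp).symm

/-! ### Minimax optimality -/

/-- For all parameters and all Schur-monotone objectives: the hindsight optimum is attained on every
request sequence (so that the `sSup` and `sInf` in the costs are a maximum and a minimum), and the
worst-case regret of water-filling is at most that of every deterministic policy. -/
theorem mainTheorem2 (n m : ℕ) (q α : ℝ) (hq : 0 < q) (hα : 0 ≤ α) :
    (∀ f : (Fin n → ℝ) → ℝ, (∀ x, 0 ≤ x → 0 ≤ f x) → SchurConcave f →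
      (∀ E ∈ requestSeqs n m q, ∃ ℓ ∈ feasibleLoads E, IsMaxOn f (feasibleLoads E) ℓ) ∧
      ∀ A : DetPolicy n, regMax m q α f (waterFilling n) ≤ regMax m q α f A) ∧
    (∀ g : (Fin n → ℝ) → ℝ, (∀ x, 0 ≤ x → 0 ≤ g x) → SchurConvex g →
      (∀ E ∈ requestSeqs n m q, ∃ ℓ ∈ feasibleLoads E, IsMinOn g (feasibleLoads E) ℓ) ∧
      ∀ A : DetPolicy n, regMin m q α g (waterFilling n) ≤ regMin m q α g A) := by
  have hnn {E : List (Request n)} {ℓ : Fin n → ℝ} (h : ℓ ∈ feasibleLoads E) : 0 ≤ ℓ :=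
    nonneg_of_mem_feasibleLoads h
  refine ⟨fun f _ hf => ?_, fun g _ hg => ?_⟩
  · have hopt (E : List (Request n)) : ∃ ℓ ∈ feasibleLoads E, IsMaxOn f (feasibleLoads E) ℓ := by
      obtain ⟨ℓ, hℓ, hmaj⟩ := exists_least_majorized E
      exact ⟨ℓ, hℓ, fun ℓ' hℓ' => hf ℓ ℓ' (hnn hℓ) (hnn hℓ') (hmaj ℓ' hℓ')⟩
    refine ⟨fun E _ => hopt E, fun A => iSup₂_le fun E hE => ?_⟩
    obtain ⟨E', hE', hmaj, hfeas⟩ := exists_adversarial_seq A hE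
    refine le_iSup₂_of_le E' hE' (EReal.coe_le_coe_iff.2 (sub_le_sub ?_ ?_))
    · refine mul_le_mul_of_nonneg_left ?_ hα
      -- The attained maximum supplies the upper bound needed by `le_csSup`; continuity of `f` is
      -- not available.
      obtain ⟨ℓ₀, -, hmax⟩ := hopt E'
      refine csSup_le ((feasibleLoads_nonempty E).image f) ?_
      rintro _ ⟨ℓ, hℓ, rfl⟩
      obtain ⟨ℓ', hℓ', hm, -⟩ := hfeas ℓ hℓ
      refine (hf ℓ' ℓ (hnn hℓ') (hnn hℓ) hm).trans (le_csSup ⟨f ℓ₀, ?_⟩ ⟨ℓ', hℓ', rfl⟩)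
      rintro _ ⟨y, hy, rfl⟩
      exact hmax hy
    · exact hf _ _ (hnn (DetPolicy.finalLoad_mem _ _)) (hnn (A.finalLoad_mem _)) hmaj
  · have hopt (E : List (Request n)) : ∃ ℓ ∈ feasibleLoads E, IsMinOn g (feasibleLoads E) ℓ := by
      obtain ⟨ℓ, hℓ, hmaj⟩ := exists_least_majorized E
      exact ⟨ℓ, hℓ, fun ℓ' hℓ' => hg ℓ ℓ' (hnn hℓ) (hnn hℓ') (hmaj ℓ' hℓ')⟩
    refine ⟨fun E _ => hopt E, fun A => iSup₂_le fun E hE => ?_⟩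
    obtain ⟨E', hE', hmaj, hfeas⟩ := exists_adversarial_seq A hE
    refine le_iSup₂_of_le E' hE' (EReal.coe_le_coe_iff.2 (sub_le_sub ?_ ?_))
    · exact hg _ _ (hnn (DetPolicy.finalLoad_mem _ _)) (hnn (A.finalLoad_mem _)) hmaj
    · refine mul_le_mul_of_nonneg_left ?_ hα
      obtain ⟨ℓ₀, -, hmin⟩ := hopt E'
      refine le_csInf ((feasibleLoads_nonempty E).image g) ?_
      rintro _ ⟨ℓ, hℓ, rfl⟩
      obtain ⟨ℓ', hℓ', hm, -⟩ := hfeas ℓ hℓ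
      refine (csInf_le ⟨g ℓ₀, ?_⟩ (Set.mem_image_of_mem g hℓ')).trans (hg ℓ' ℓ (hnn hℓ') (hnn hℓ) hm)
      rintro _ ⟨y, hy, rfl⟩
      exact hmin hy
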